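/- All groups are finite and all representations are finite-dimensional over $\mathbb{C}$. For a finite group $G$ let $Z^2(G,\mathbb{C}^\times)$ be the group of $2$-cocycles for the trivial action. For $\alpha\in Z^2(G,\mathbb{C}^\times)$, an $\alpha$-representation is a map $\rho:G\to \mathrm{GL}(V)$ with $\rho(x)\rho(y)=\alpha(x,y)\rho(xy)$ for all $x,y\in G$. It is irreducible if $V\neq 0$ and $V$ has no proper nonzero $\rho(G)$-invariant subspace, and it is faithful if $1$ is the only $g\in G$ for which $\rho(g)$ is a scalar multiple of the identity. An element $x\in Z(G)$ is an $\alpha$-regular element of $Z(G)$ if $\alpha(g,x)=\alpha(x,g)$ for all $g\in G$. Let $p$ be a prime, let $H$ and $K$ be non-abelian finite $p$-groups, and let $G=H\times K$. For $\alpha\in Z^2(G,\mathbb{C}^\times)$, $\beta\in Z^2(H,\mathbb{C}^\times)$, $\gamma\in Z^2(K,\mathbb{C}^\times)$ and $f\in \mathrm{Hom}(H/H'\otimes_{\mathbb{Z}} K/K',\mathbb{C}^\times)$ write $\alpha=(\beta,\gamma,f)$ if $\alpha$ is cohomologous to the cocycle $$\big((h_1,k_1),(h_2,k_2)\big)\longmapsto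 \beta(h_1,h_2)\,\gamma(k_1,k_2)\,f(\overline{h_1}\otimes\overline{k_2}).$$ **Theorem.** Let $\alpha\in Z^2(G,\mathbb{C}^\times)$. 1. If $\alpha=(1,1,f)$ for some $f$, then no irreducible $\alpha$-representation of $G$ is faithful. 2. Suppose that $Z(G)\subseteq G'$ and $\alpha=(\beta,\gamma,f)$. Then an irreducible $\alpha$-representation of $G$ is faithful if and only if $1$ is the only $\beta$-regular element of $Z(H)$ and $1$ is the only $\gamma$-regular element of $Z(K)$. Furthermore, $G$ has a faithful irreducible $\alpha$-representation if and only if $H$ has a faithful irreducible $\beta$-representation and $K$ has a faithful irreducible $\gamma$-representation. -/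

import Mathlib

open scoped TensorProduct

/-- The trivial action of `G` on `ℂˣ`. -/
abbrev trivialAction (G : Type*) : SMul G ℂˣ := ⟨fun _ z => z⟩

/-- `α ∈ Z²(G, ℂˣ)`, where `G` acts trivially on `ℂˣ`. -/
def IsCocycle {G : Type*} [Group G] (α : G × G → ℂˣ) : Prop :=
  letI := trivialAction G
  groupCohomology.IsMulCocycle₂ α

/-- `α ∈ B²(G, ℂˣ)`, where `G` acts trivially on `ℂˣ`. -/
def IsCoboundary {G : Type*} [Group G] (α : G × G → ℂˣ) : Prop :=
  letI := trivialAction G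
  groupCohomology.IsMulCoboundary₂ α

theorem isCocycle_iff {G : Type*} [Group G] (α : G × G → ℂˣ) :
    IsCocycle α ↔ ∀ x y z : G, α (x * y, z) * α (x, y) = α (y, z) * α (x, y * z) :=
  Iff.rfl

theorem isCoboundary_iff {G : Type*} [Group G] (α : G × G → ℂˣ) :
    IsCoboundary α ↔ ∃ t : G → ℂˣ, ∀ x y : G, t y / t (x * y) * t x = α (x, y) :=
  Iff.rfl

/-- For cocycles: `[α] = [β]` in `H²(G, ℂˣ)`. -/
def Cohomologous {G : Type*} [Group G] (α β : G × G → ℂˣ) : Prop :=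
  IsCoboundary (α / β)

/-- An `α`-representation of `G` on `V`: a map `ρ : G → GL(V)` with
`ρ(x) ρ(y) = α(x, y) ρ(x y)`. (This forces `ρ(1) = α(1, 1) I`, so `ρ(1) = I` if `α` is
normalized.) -/
structure ProjRep {G : Type*} [Group G] (α : G × G → ℂˣ) (V : Type*) [AddCommGroup V]
    [Module ℂ V] where
  toFun : G → LinearMap.GeneralLinearGroup ℂ V
  map_mul : ∀ x y : G,
    (toFun x : V →ₗ[ℂ] V) * (toFun y : V →ₗ[ℂ] V)
      = (α (x, y) : ℂ) • (toFun (x * y) : V →ₗ[ℂ] V)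

namespace ProjRep

variable {G : Type*} [Group G] {α : G × G → ℂˣ} {V : Type*} [AddCommGroup V] [Module ℂ V]

/-- The space is nonzero and has no proper nonzero invariant subspace. -/
def IsIrreducible (ρ : ProjRep α V) : Prop :=
  Nontrivial V ∧ ∀ W : Submodule ℂ V,
    (∀ g : G, ∀ w ∈ W, (ρ.toFun g : V →ₗ[ℂ] V) w ∈ W) → W = ⊥ ∨ W = ⊤

/-- The projective kernel: the elements that act by scalars. -/
def ker (ρ : ProjRep α V) : Set G :=
  {g | ∃ c : ℂˣ, (ρ.toFun g : V →ₗ[ℂ] V) = (c : ℂ) • LinearMap.id}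

/-- Faithful as a projective representation. -/
def IsFaithful (ρ : ProjRep α V) : Prop :=
  ρ.ker = {1}

end ProjRep

/-- `G` has a faithful irreducible `α`-representation on some finite-dimensional complex space.
(Such a space is isomorphic to some `ℂⁿ`, so `V : Type` is no restriction.) -/
def HasFaithfulIrreducible {G : Type*} [Group G] (α : G × G → ℂˣ) : Prop :=
  ∃ (V : Type) (_ : AddCommGroup V) (_ : Module ℂ V) (_ : FiniteDimensional ℂ V)
    (ρ : ProjRep α V), ρ.IsIrreducible ∧ ρ.IsFaithful

/-- `x` is an `α`-regular element of `G`. -/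
def IsRegularElement {G : Type*} [Group G] (α : G × G → ℂˣ) (x : G) : Prop :=
  ∀ g ∈ Subgroup.centralizer ({x} : Set G), α (g, x) = α (x, g)

/-- The set of `α`-regular elements of `Z(G)`: central elements that are `α`-regular in `G`. -/
def centralRegular {G : Type*} [Group G] (α : G × G → ℂˣ) : Set G :=
  {x | x ∈ Subgroup.center G ∧ IsRegularElement α x}

/-- The abelian tensor product `H/H' ⊗_ℤ K/K'`, written additively. -/
abbrev AbTensor (H K : Type*) [Group H] [Group K] : Type _ :=
  Additive (Abelianization H) ⊗[ℤ] Additive (Abelianization K)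

/-- The value `f(h̄ ⊗ k̄)`. -/
def pairing {H K : Type*} [Group H] [Group K] (f : AbTensor H K →+ Additive ℂˣ)
    (h : H) (k : K) : ℂˣ :=
  (f (Additive.ofMul (Abelianization.of h) ⊗ₜ[ℤ] Additive.ofMul (Abelianization.of k))).toMul

/-- The cocycle `((h₁, k₁), (h₂, k₂)) ↦ β(h₁, h₂) γ(k₁, k₂) f(h̄₁ ⊗ k̄₂)` of `H × K`. -/
def prodCocycle {H K : Type*} [Group H] [Group K] (β : H × H → ℂˣ) (γ : K × K → ℂˣ)
    (f : AbTensor H K →+ Additive ℂˣ) : (H × K) × (H × K) → ℂˣ :=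
  fun q => β (q.1.1, q.2.1) * γ (q.1.2, q.2.2) * pairing f q.1.1 q.2.2

/-- `α = (β, γ, f)`: the class of `α` is the image of `([β], [γ], f)` under the isomorphism
`H²(H, ℂˣ) × H²(K, ℂˣ) × Hom(H ⊗ K, ℂˣ) ≅ H²(H × K, ℂˣ)`. -/
def CorrespondsTo {H K : Type*} [Group H] [Group K] (α : (H × K) × (H × K) → ℂˣ)
    (β : H × H → ℂˣ) (γ : K × K → ℂˣ) (f : AbTensor H K →+ Additive ℂˣ) : Prop :=
  Cohomologous α (prodCocycle β γ f)

/-! The projective kernel of `ρ` is a normal subgroup, and in a finite p-group a nontrivial normal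
subgroup meets the center. So faithfulness is decided on `Z(G)`. For irreducible `ρ`, the central
elements acting by scalars are exactly the central α-regular ones: Schur's lemma gives one inclusion
(`IsIrreducible.centralRegular_subset_ker`), comparing `ρ(g)ρ(x)` with `ρ(x)ρ(g)` the other
(`mem_centralRegular_of_mem_ker`). Hence faithfulness depends only on the class of α, and an
irreducible constituent of the twisted regular representation settles existence.

For `H × K`, the bilinear term `f` is trivial on commutators, so on `Z(G) ∩ G'` regularity splits
into its two components. With β = γ = 1, a nontrivial `h ∈ Z(H) ∩ H'` gives a regular `(h, 1)`,
which excludes faithfulness. If `Z(G) ⊆ G'`, the splitting covers the whole center. -/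

/-- A nontrivial normal subgroup of a finite `p`-group meets the center nontrivially. -/
theorem IsPGroup.exists_ne_one_mem_center {G : Type*} [Group G] [Finite G] {p : ℕ}
    (hp : p.Prime) (hG : IsPGroup p G) (N : Subgroup G) [N.Normal] (hN : N ≠ ⊥) :
    ∃ x ∈ N, x ∈ Subgroup.center G ∧ x ≠ 1 := by
  have : Fact p.Prime := ⟨hp⟩
  have hdvd : p ∣ Nat.card N := by
    rcases (hG.to_subgroup N).card_eq_or_dvd with h | h
    · exact absurd (Subgroup.card_eq_one.mp h) hN
    · exact h
  have hG' : IsPGroup p (ConjAct G) := hG.of_equiv ConjAct.toConjAct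
  have h1 : (1 : N) ∈ MulAction.fixedPoints (ConjAct G) N := fun g => smul_one g
  obtain ⟨x, hx, hx1⟩ := hG'.exists_fixed_point_of_prime_dvd_card_of_fixed_point N hdvd h1
  refine ⟨x, x.2, Subgroup.mem_center_iff.mpr fun g => ?_, fun h => hx1 (Subtype.ext h.symm)⟩
  have := congrArg Subtype.val (hx (ConjAct.toConjAct g))
  rw [ConjAct.Subgroup.val_conj_smul, ConjAct.toConjAct_smul] at this
  exact mul_inv_eq_iff_eq_mul.mp this

/-- The derived subgroup of a non-abelian finite `p`-group meets the center nontrivially. -/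
theorem IsPGroup.exists_ne_one_mem_center_commutator {G : Type*} [Group G] [Finite G] {p : ℕ}
    (hp : p.Prime) (hG : IsPGroup p G) (hna : ¬ ∀ a b : G, a * b = b * a) :
    ∃ x ∈ commutator G, x ∈ Subgroup.center G ∧ x ≠ 1 := by
  refine hG.exists_ne_one_mem_center hp (commutator G) fun h => hna fun a b => ?_
  have hab := Subgroup.commutator_mem_commutator (Subgroup.mem_top a) (Subgroup.mem_top b)
  rw [← commutator_def, h, Subgroup.mem_bot] at hab
  exact commutatorElement_eq_one_iff_mul_comm.mp hab

/-! ### Central regular elements and cohomology -/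

section Cocycle

variable {G : Type*} [Group G] {α β : G × G → ℂˣ}

theorem IsCocycle.map_one_comm (hα : IsCocycle α) (g : G) : α (g, 1) = α (1, g) := by
  have h1 := (isCocycle_iff α).mp hα g 1 1
  have h2 := (isCocycle_iff α).mp hα 1 1 g
  simp only [mul_one, one_mul] at h1 h2
  rw [mul_left_inj] at h1
  rw [mul_comm, mul_left_inj] at h2
  exact h1.trans h2

theorem mem_centralRegular_iff (x : G) :
    x ∈ centralRegular α ↔ x ∈ Subgroup.center G ∧ ∀ g, α (g, x) = α (x, g) := by
  refine and_congr_right fun hx => ⟨fun h g => h g ?_, fun h g _ => h g⟩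
  rw [Subgroup.mem_centralizer_singleton_iff]
  exact Subgroup.mem_center_iff.mp hx g

theorem IsCocycle.one_mem_centralRegular (hα : IsCocycle α) : (1 : G) ∈ centralRegular α :=
  (mem_centralRegular_iff 1).mpr ⟨Subgroup.one_mem _, hα.map_one_comm⟩

/-- A coboundary is symmetric on commuting pairs, so it cancels from the regularity condition. -/
theorem Cohomologous.centralRegular_eq (h : Cohomologous α β) :
    centralRegular α = centralRegular β := by
  obtain ⟨t, ht⟩ := (isCoboundary_iff _).mp h
  have key : ∀ x y, α (x, y) = t y / t (x * y) * t x * β (x, y) := fun x y => by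
    rw [ht x y, Pi.div_apply, div_mul_cancel]
  ext x
  rw [mem_centralRegular_iff, mem_centralRegular_iff]
  refine and_congr_right fun hx => forall_congr' fun g => ?_
  have hcomm : t g / t (x * g) * t x = t x / t (g * x) * t g := by
    rw [Subgroup.mem_center_iff.mp hx g, div_mul_eq_mul_div, div_mul_eq_mul_div, mul_comm]
  rw [key g x, key x g, hcomm, mul_right_inj]

end Cocycle

/-! ### Projective kernels, Schur's lemma and existence of irreducibles -/

namespace ProjRep

variable {G : Type*} [Group G] {α : G × G → ℂˣ} {V : Type*} [AddCommGroup V] [Module ℂ V]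

theorem apply_apply (ρ : ProjRep α V) (x y : G) (v : V) :
    (ρ.toFun x : V →ₗ[ℂ] V) ((ρ.toFun y : V →ₗ[ℂ] V) v)
      = (α (x, y) : ℂ) • (ρ.toFun (x * y) : V →ₗ[ℂ] V) v :=
  LinearMap.congr_fun (ρ.map_mul x y) v

theorem toFun_mul (ρ : ProjRep α V) (x y : G) :
    (ρ.toFun (x * y) : V →ₗ[ℂ] V)
      = ((α (x, y))⁻¹ : ℂˣ).val • ((ρ.toFun x : V →ₗ[ℂ] V) * (ρ.toFun y : V →ₗ[ℂ] V)) := by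
  rw [ρ.map_mul, smul_smul, ← Units.val_mul, inv_mul_cancel, Units.val_one, one_smul]

theorem toFun_one (ρ : ProjRep α V) :
    (ρ.toFun 1 : V →ₗ[ℂ] V) = (α (1, 1) : ℂ) • LinearMap.id := by
  have h := ρ.map_mul 1 1
  rw [mul_one] at h
  refine (ρ.toFun 1).isUnit.mul_right_cancel (h.trans ?_)
  rw [smul_mul_assoc]
  rfl

theorem one_mem_ker (ρ : ProjRep α V) : (1 : G) ∈ ρ.ker := ⟨_, ρ.toFun_one⟩

theorem mul_mem_ker (ρ : ProjRep α V) {x y : G} (hx : x ∈ ρ.ker) (hy : y ∈ ρ.ker) :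
    x * y ∈ ρ.ker := by
  obtain ⟨c, hc⟩ := hx
  obtain ⟨d, hd⟩ := hy
  refine ⟨(α (x, y))⁻¹ * (c * d), ?_⟩
  rw [ρ.toFun_mul, hc, hd]
  ext v
  simp [mul_smul, smul_comm (d : ℂ) (c : ℂ)]

theorem conj_mem_ker (ρ : ProjRep α V) {x : G} (hx : x ∈ ρ.ker) (g : G) :
    g * x * g⁻¹ ∈ ρ.ker := by
  obtain ⟨c, hc⟩ := hx
  -- Cocycles need not be normalized: `ρ(g)ρ(g⁻¹)` is the scalar `α(g, g⁻¹) α(1, 1)`.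
  refine ⟨(α (g * x, g⁻¹))⁻¹ * ((α (g, x))⁻¹ * (c * (α (g, g⁻¹) * α (1, 1)))), ?_⟩
  rw [ρ.toFun_mul, ρ.toFun_mul, hc]
  ext v
  have h := ρ.apply_apply g g⁻¹ v
  rw [mul_inv_cancel, ρ.toFun_one] at h
  simp only [LinearMap.smul_apply, Module.End.mul_apply, map_smul, LinearMap.id_apply] at h ⊢
  rw [h]
  simp only [Units.val_mul, mul_smul]

theorem inv_mem_ker (ρ : ProjRep α V) {x : G} (hx : x ∈ ρ.ker) : x⁻¹ ∈ ρ.ker := by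
  obtain ⟨c, hc⟩ := hx
  refine ⟨c⁻¹ * (α (x, x⁻¹) * α (1, 1)), ?_⟩
  ext v
  have h := ρ.apply_apply x x⁻¹ v
  rw [mul_inv_cancel, ρ.toFun_one, hc] at h
  simp only [LinearMap.smul_apply, LinearMap.id_apply] at h ⊢
  rw [Units.val_mul, mul_smul, Units.val_mul, mul_smul, ← h, smul_smul, ← Units.val_mul,
    inv_mul_cancel, Units.val_one, one_smul]

/-- The projective kernel as a subgroup. -/
def kerSubgroup (ρ : ProjRep α V) : Subgroup G where
  carrier := ρ.ker
  one_mem' := ρ.one_mem_ker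
  mul_mem' := ρ.mul_mem_ker
  inv_mem' := ρ.inv_mem_ker

instance kerSubgroup_normal (ρ : ProjRep α V) : ρ.kerSubgroup.Normal :=
  ⟨fun _ hx g => ρ.conj_mem_ker hx g⟩

/-- If `ρ(x) = c`, then `α(g, x) ρ(gx) = c ρ(g) = α(x, g) ρ(xg)`. Since `gx = xg`, evaluating at a
nonzero vector cancels the operator. -/
theorem mem_centralRegular_of_mem_ker [Nontrivial V] (ρ : ProjRep α V) {x : G}
    (hx : x ∈ ρ.ker) (hxc : x ∈ Subgroup.center G) : x ∈ centralRegular α := by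
  refine (mem_centralRegular_iff x).mpr ⟨hxc, fun g => ?_⟩
  obtain ⟨c, hc⟩ := hx
  have hgx := ρ.map_mul g x
  have hxg := ρ.map_mul x g
  rw [hc, ← Subgroup.mem_center_iff.mp hxc g] at hxg
  rw [hc] at hgx
  obtain ⟨v, hv⟩ := exists_ne (0 : V)
  have hinj : Function.Injective (ρ.toFun (g * x) : V →ₗ[ℂ] V) :=
    ((Module.End.isUnit_iff _).mp (ρ.toFun (g * x)).isUnit).injective
  have hw : (ρ.toFun (g * x) : V →ₗ[ℂ] V) v ≠ 0 := fun h => hv (hinj (h.trans (map_zero _).symm))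
  have h1 := LinearMap.congr_fun hgx v
  have h2 := LinearMap.congr_fun hxg v
  simp only [LinearMap.smul_apply, Module.End.mul_apply, map_smul, LinearMap.id_apply] at h1 h2
  exact Units.ext (smul_left_injective ℂ hw (h1.symm.trans h2))

/-- **Schur's lemma** for central regular elements. -/
theorem IsIrreducible.centralRegular_subset_ker [FiniteDimensional ℂ V] {ρ : ProjRep α V}
    (hρ : ρ.IsIrreducible) : centralRegular α ⊆ ρ.ker := by
  intro x hx
  obtain ⟨hxc, hreg⟩ := (mem_centralRegular_iff x).mp hx
  obtain ⟨hnt, hirr⟩ := hρ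
  obtain ⟨c, hc⟩ := Module.End.exists_eigenvalue (ρ.toFun x : Module.End ℂ V)
  -- Regularity and centrality make `ρ(x)` commute with every `ρ(g)`, so its eigenspaces are
  -- invariant.
  have htop : Module.End.eigenspace (ρ.toFun x : Module.End ℂ V) c = ⊤ := by
    refine (hirr _ fun g w hw => ?_).resolve_left hc
    rw [Module.End.mem_eigenspace_iff] at hw ⊢
    rw [ρ.apply_apply, ← hreg g, ← Subgroup.mem_center_iff.mp hxc g, ← ρ.apply_apply, hw, map_smul]
  have hv : ∀ v, (ρ.toFun x : V →ₗ[ℂ] V) v = c • v := fun v =>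
    Module.End.mem_eigenspace_iff.mp (htop ▸ Submodule.mem_top)
  have hc0 : c ≠ 0 := by
    rintro rfl
    obtain ⟨v, hv0⟩ := exists_ne (0 : V)
    have hinj : Function.Injective (ρ.toFun x : V →ₗ[ℂ] V) :=
      ((Module.End.isUnit_iff _).mp (ρ.toFun x).isUnit).injective
    exact hv0 (hinj (by rw [hv, zero_smul, map_zero]))
  exact ⟨Units.mk0 c hc0, LinearMap.ext hv⟩

/-- For a finite `p`-group, faithfulness of an irreducible `α`-representation depends only
on `α`. -/
theorem IsIrreducible.isFaithful_iff [Finite G] [FiniteDimensional ℂ V] {p : ℕ} (hp : p.Prime)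
    (hG : IsPGroup p G) (hα : IsCocycle α) {ρ : ProjRep α V} (hρ : ρ.IsIrreducible) :
    ρ.IsFaithful ↔ centralRegular α = {1} := by
  constructor
  · intro h
    refine Set.Subset.antisymm (hρ.centralRegular_subset_ker.trans h.subset) ?_
    exact Set.singleton_subset_iff.mpr hα.one_mem_centralRegular
  · intro h
    have := hρ.1
    have hbot : ρ.kerSubgroup = ⊥ := by
      by_contra hne
      obtain ⟨x, hx, hxc, hx1⟩ := hG.exists_ne_one_mem_center hp ρ.kerSubgroup hne
      exact hx1 (h.subset (ρ.mem_centralRegular_of_mem_ker hx hxc))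
    have := congrArg (fun N : Subgroup G => (N : Set G)) hbot
    rwa [Subgroup.coe_bot] at this

/-- Invertibility comes for free: `T(g⁻¹) T(g)` is a nonzero multiple of the injective `T(1)`, and
the dimension is finite. -/
theorem exists_of_linearMap [FiniteDimensional ℂ V] (T : G → V →ₗ[ℂ] V)
    (hT : ∀ x y, T x * T y = (α (x, y) : ℂ) • T (x * y)) (h1 : Function.Injective (T 1)) :
    ∃ ρ : ProjRep α V, ∀ g, (ρ.toFun g : V →ₗ[ℂ] V) = T g := by
  have hu : ∀ g, IsUnit (T g) := by
    intro g
    rw [LinearMap.isUnit_iff_ker_eq_bot, LinearMap.ker_eq_bot]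
    have h := hT g⁻¹ g
    rw [inv_mul_cancel] at h
    have hinj : Function.Injective (T g⁻¹ * T g : V →ₗ[ℂ] V) := by
      rw [h]
      exact (smul_right_injective V (α (g⁻¹, g)).ne_zero).comp h1
    exact Function.Injective.of_comp hinj
  exact ⟨⟨fun g => (hu g).unit, hT⟩, fun g => rfl⟩

/-- The twisted regular representation, on `ℂⁿ` with `n = |G|`. -/
theorem exists_regular [Finite G] (hα : IsCocycle α) :
    Nonempty (ProjRep α (Fin (Nat.card G) → ℂ)) := by
  let e : Fin (Nat.card G) ≃ G := (Finite.equivFin G).symm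
  -- In coordinates, the action `x · e_y = α(x, y) e_{xy}` on the basis indexed by `G`.
  let T : G → (Fin (Nat.card G) → ℂ) →ₗ[ℂ] (Fin (Nat.card G) → ℂ) := fun x =>
    { toFun := fun v i => (α (x, x⁻¹ * e i) : ℂ) * v (e.symm (x⁻¹ * e i))
      map_add' := fun v w => funext fun i => mul_add _ _ _
      map_smul' := fun c v => funext fun i => mul_left_comm _ _ _ }
  have happ : ∀ x v i, T x v i = (α (x, x⁻¹ * e i) : ℂ) * v (e.symm (x⁻¹ * e i)) :=
    fun _ _ _ => rfl
  refine (exists_of_linearMap (α := α) T (fun x y => ?_) (fun v w hvw => ?_)).nonempty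
  · refine LinearMap.ext fun v => funext fun i => ?_
    have h := (isCocycle_iff α).mp hα x y ((x * y)⁻¹ * e i)
    have hy : y * ((x * y)⁻¹ * e i) = x⁻¹ * e i := by group
    have hxy : y⁻¹ * (x⁻¹ * e i) = (x * y)⁻¹ * e i := by group
    rw [hy] at h
    rw [Module.End.mul_apply, LinearMap.smul_apply, Pi.smul_apply, smul_eq_mul, happ, happ, happ,
      Equiv.apply_symm_apply, hxy, ← mul_assoc, ← mul_assoc, ← Units.val_mul, ← Units.val_mul,
      mul_comm (α (x, y)), h, mul_comm (α (y, _))]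
  · funext i
    have h := congrFun hvw i
    rw [happ, happ, inv_one, one_mul, Equiv.symm_apply_apply] at h
    exact mul_left_cancel₀ (Units.ne_zero _) h

/-- Every nonzero finite-dimensional `α`-representation contains an irreducible one. -/
theorem exists_irreducible_restriction [FiniteDimensional ℂ V] [Nontrivial V] (ρ : ProjRep α V) :
    ∃ (W : Submodule ℂ V) (σ : ProjRep α W), σ.IsIrreducible := by
  let S : Set (Submodule ℂ V) :=
    {W | W ≠ ⊥ ∧ ∀ g, ∀ w ∈ W, (ρ.toFun g : V →ₗ[ℂ] V) w ∈ W}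
  obtain ⟨W, ⟨hW0, hWinv⟩, hmin⟩ :=
    IsArtinian.set_has_minimal S ⟨⊤, top_ne_bot, fun _ _ _ => Submodule.mem_top⟩
  obtain ⟨σ, hσ⟩ := exists_of_linearMap (α := α)
    (fun g => (ρ.toFun g : V →ₗ[ℂ] V).restrict (hWinv g))
    (fun x y => LinearMap.ext fun w => Subtype.ext (ρ.apply_apply x y w))
    (fun v w hvw => Subtype.ext
      (((Module.End.isUnit_iff _).mp (ρ.toFun 1).isUnit).injective (congrArg Subtype.val hvw)))
  refine ⟨W, σ, Submodule.nontrivial_iff_ne_bot.mpr hW0, fun U hU => ?_⟩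
  by_cases hU0 : U = ⊥
  · exact Or.inl hU0
  · right
    -- Seen inside `V`, a nonzero invariant `U` competes with the minimal `W`, so it equals `W`.
    have hmem : U.map W.subtype ∈ S := by
      refine ⟨fun h => hU0 (Submodule.map_injective_of_injective W.subtype_injective
        (h.trans (Submodule.map_bot _).symm)), ?_⟩
      rintro g _ ⟨u, hu, rfl⟩
      refine ⟨_, hU g u hu, ?_⟩
      rw [hσ g]
      rfl
    have hle : U.map W.subtype ≤ W := Submodule.map_subtype_le W U
    have heq : U.map W.subtype = W := hle.eq_of_not_lt (hmin _ hmem)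
    refine Submodule.map_injective_of_injective W.subtype_injective ?_
    rw [heq, Submodule.map_subtype_top]

end ProjRep

/-- A finite `p`-group has a faithful irreducible `α`-representation if and only if `1` is its
only central `α`-regular element. -/
theorem hasFaithfulIrreducible_iff {G : Type*} [Group G] [Finite G] {α : G × G → ℂˣ} {p : ℕ}
    (hp : p.Prime) (hG : IsPGroup p G) (hα : IsCocycle α) :
    HasFaithfulIrreducible α ↔ centralRegular α = {1} := by
  constructor
  · rintro ⟨V, _, _, _, ρ, hρ, hf⟩
    exact (hρ.isFaithful_iff hp hG hα).mp hf
  · intro h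
    obtain ⟨ρ⟩ := ProjRep.exists_regular hα
    have : Nonempty (Fin (Nat.card G)) := ⟨⟨0, Nat.card_pos⟩⟩
    obtain ⟨W, σ, hσ⟩ := ρ.exists_irreducible_restriction
    exact ⟨W, inferInstance, inferInstance, inferInstance, σ, hσ,
      (hσ.isFaithful_iff hp hG hα).mpr h⟩

/-! ### Regular elements of a direct product -/

section Product

variable {H K : Type*} [Group H] [Group K]

theorem pairing_eq_one_of_mem_commutator_left (f : AbTensor H K →+ Additive ℂˣ) {h : H}
    (hh : h ∈ commutator H) (k : K) : pairing f h k = 1 := by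
  rw [← Abelianization.ker_of, MonoidHom.mem_ker] at hh
  rw [pairing, hh, ofMul_one, TensorProduct.zero_tmul, map_zero, toMul_zero]

theorem pairing_eq_one_of_mem_commutator_right (f : AbTensor H K →+ Additive ℂˣ) (h : H) {k : K}
    (hk : k ∈ commutator K) : pairing f h k = 1 := by
  rw [← Abelianization.ker_of, MonoidHom.mem_ker] at hk
  rw [pairing, hk, ofMul_one, TensorProduct.tmul_zero, map_zero, toMul_zero]

/-- Elements of `Z(H) ∩ H' × Z(K) ∩ K'` are regular exactly when both components are. -/
theorem mem_centralRegular_prodCocycle {β : H × H → ℂˣ} {γ : K × K → ℂˣ} (hβ : IsCocycle β)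
    (hγ : IsCocycle γ) (f : AbTensor H K →+ Additive ℂˣ) {h : H} {k : K}
    (hh : h ∈ commutator H) (hk : k ∈ commutator K) :
    (h, k) ∈ centralRegular (prodCocycle β γ f) ↔
      h ∈ centralRegular β ∧ k ∈ centralRegular γ := by
  simp only [mem_centralRegular_iff, Subgroup.center_prod, Subgroup.mem_prod, Prod.forall,
    prodCocycle, pairing_eq_one_of_mem_commutator_left f hh,
    pairing_eq_one_of_mem_commutator_right f _ hk, mul_one]
  constructor
  · rintro ⟨⟨hhc, hkc⟩, hreg⟩
    refine ⟨⟨hhc, fun a => ?_⟩, hkc, fun b => ?_⟩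
    -- Testing against `(a, 1)` isolates β, since the γ-factors agree at the identity.
    · have := hreg a 1
      rwa [hγ.map_one_comm, mul_left_inj] at this
    · have := hreg 1 b
      rwa [hβ.map_one_comm, mul_right_inj] at this
  · rintro ⟨⟨hhc, h1⟩, hkc, h2⟩
    exact ⟨⟨hhc, hkc⟩, fun a b => by rw [h1, h2]⟩

theorem mem_commutator_of_mem_center_left
    (hZ : Subgroup.center (H × K) ≤ commutator (H × K)) {h : H} (hh : h ∈ Subgroup.center H) :
    h ∈ commutator H := by
  have hmem : (h, (1 : K)) ∈ commutator (H × K) := hZ <| by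
    rw [Subgroup.center_prod]
    exact ⟨hh, Subgroup.one_mem _⟩
  rw [← Abelianization.ker_of, MonoidHom.mem_ker]
  exact Abelianization.commutator_subset_ker (Abelianization.of.comp (MonoidHom.fst H K)) hmem

theorem mem_commutator_of_mem_center_right
    (hZ : Subgroup.center (H × K) ≤ commutator (H × K)) {k : K} (hk : k ∈ Subgroup.center K) :
    k ∈ commutator K := by
  have hmem : ((1 : H), k) ∈ commutator (H × K) := hZ <| by
    rw [Subgroup.center_prod]
    exact ⟨Subgroup.one_mem _, hk⟩
  rw [← Abelianization.ker_of, MonoidHom.mem_ker]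
  exact Abelianization.commutator_subset_ker (Abelianization.of.comp (MonoidHom.snd H K)) hmem

/-- The inclusion `Z(G) ⊆ G'` puts both components of a central element into derived subgroups,
where `f` contributes nothing. -/
theorem centralRegular_prodCocycle {β : H × H → ℂˣ} {γ : K × K → ℂˣ} (hβ : IsCocycle β)
    (hγ : IsCocycle γ) (f : AbTensor H K →+ Additive ℂˣ)
    (hZ : Subgroup.center (H × K) ≤ commutator (H × K)) :
    centralRegular (prodCocycle β γ f) = centralRegular β ×ˢ centralRegular γ := by
  ext ⟨h, k⟩
  rw [Set.mem_prod]
  constructor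
  · intro hx
    have hc : h ∈ Subgroup.center H ∧ k ∈ Subgroup.center K := by
      have := hx.1
      rwa [Subgroup.center_prod, Subgroup.mem_prod] at this
    exact (mem_centralRegular_prodCocycle hβ hγ f (mem_commutator_of_mem_center_left hZ hc.1)
      (mem_commutator_of_mem_center_right hZ hc.2)).mp hx
  · intro hx
    exact (mem_centralRegular_prodCocycle hβ hγ f (mem_commutator_of_mem_center_left hZ hx.1.1)
      (mem_commutator_of_mem_center_right hZ hx.2.1)).mpr hx

theorem centralRegular_prod_eq_singleton_one_iff {β : H × H → ℂˣ} {γ : K × K → ℂˣ}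
    (hβ : IsCocycle β) (hγ : IsCocycle γ) :
    centralRegular β ×ˢ centralRegular γ = {1} ↔
      centralRegular β = {1} ∧ centralRegular γ = {1} := by
  constructor
  · intro h
    refine ⟨Set.eq_singleton_iff_unique_mem.mpr ⟨hβ.one_mem_centralRegular, fun x hx => ?_⟩,
      Set.eq_singleton_iff_unique_mem.mpr ⟨hγ.one_mem_centralRegular, fun x hx => ?_⟩⟩
    · exact congrArg Prod.fst (h.subset (Set.mk_mem_prod hx hγ.one_mem_centralRegular))
    · exact congrArg Prod.snd (h.subset (Set.mk_mem_prod hβ.one_mem_centralRegular hx))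
  · rintro ⟨h1, h2⟩
    rw [h1, h2, Set.singleton_prod_singleton]
    rfl

end Product

theorem isCocycle_one (G : Type*) [Group G] : IsCocycle (1 : G × G → ℂˣ) :=
  (isCocycle_iff _).mpr fun _ _ _ => rfl

theorem mainTheorem8 {H : Type*} {K : Type*} [Group H] [Group K] [Finite H] [Finite K]
    (p : ℕ) (hp : p.Prime) (hH : IsPGroup p H) (hK : IsPGroup p K)
    (hHna : ¬ ∀ a b : H, a * b = b * a) (hKna : ¬ ∀ a b : K, a * b = b * a)
    (α : (H × K) × (H × K) → ℂˣ) (hα : IsCocycle α)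
    (f : AbTensor H K →+ Additive ℂˣ) :
    (CorrespondsTo α 1 1 f →
      ∀ (V : Type*) [AddCommGroup V] [Module ℂ V] [FiniteDimensional ℂ V] (ρ : ProjRep α V),
        ρ.IsIrreducible → ¬ ρ.IsFaithful) ∧
    (Subgroup.center (H × K) ≤ commutator (H × K) →
      ∀ (β : H × H → ℂˣ) (γ : K × K → ℂˣ), IsCocycle β → IsCocycle γ → CorrespondsTo α β γ f →
        (∀ (V : Type*) [AddCommGroup V] [Module ℂ V] [FiniteDimensional ℂ V] (ρ : ProjRep α V),
          ρ.IsIrreducible →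
            (ρ.IsFaithful ↔ centralRegular β = {1} ∧ centralRegular γ = {1})) ∧
        (HasFaithfulIrreducible α ↔ HasFaithfulIrreducible β ∧ HasFaithfulIrreducible γ)) := by
  constructor
  · intro hcorr V _ _ _ ρ hρ hf
    obtain ⟨h, hh, hc, h1⟩ := hH.exists_ne_one_mem_center_commutator hp hHna
    have hreg : (h, (1 : K)) ∈ centralRegular α := by
      rw [Cohomologous.centralRegular_eq hcorr, mem_centralRegular_prodCocycle (isCocycle_one H)
        (isCocycle_one K) f hh (Subgroup.one_mem _)]
      exact ⟨(mem_centralRegular_iff h).mpr ⟨hc, fun _ => rfl⟩,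
        (isCocycle_one K).one_mem_centralRegular⟩
    exact h1 (congrArg Prod.fst (hf.subset (hρ.centralRegular_subset_ker hreg)))
  · intro hZ β γ hβ hγ hcorr
    have : Fact p.Prime := ⟨hp⟩
    have hG : IsPGroup p (H × K) := by
      obtain ⟨m, hm⟩ := IsPGroup.iff_card.mp hH
      obtain ⟨n, hn⟩ := IsPGroup.iff_card.mp hK
      exact IsPGroup.of_card (n := m + n) (by rw [Nat.card_prod, hm, hn, pow_add])
    have key : centralRegular α = {1} ↔ centralRegular β = {1} ∧ centralRegular γ = {1} := by
      rw [Cohomologous.centralRegular_eq hcorr, centralRegular_prodCocycle hβ hγ f hZ,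
        centralRegular_prod_eq_singleton_one_iff hβ hγ]
    refine ⟨fun V _ _ _ ρ hρ => (hρ.isFaithful_iff hp hG hα).trans key, ?_⟩
    rw [hasFaithfulIrreducible_iff hp hG hα, hasFaithfulIrreducible_iff hp hH hβ,
      hasFaithfulIrreducible_iff hp hK hγ]
    exact key
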